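/- Let $X$ be a Hausdorff space, let $E$ be an equivalence relation on $X$ that is co-analytic as a subset of $X \times X$ (i.e. its complement $(X \times X) \setminus E$ is a continuous image of a closed subset of $\mathbb{N}^{\mathbb{N}}$), and let $R$ be a reflexive binary relation on $X$ that is $G_\delta$ as a subset of $X \times X$ (i.e. a countable intersection of open sets). A set $Y \subseteq X$ is an $R$-clique if $x \mathrel{R} y$ for all distinct $x, y \in Y$, and a partial transversal of $E$ if it does not contain two distinct $E$-related points. Suppose that some $R$-clique $Y \subseteq X$ intersects uncountably many $E$-classes. Then there is a Cantor set $C \subseteq X$, i.e. a subspace of $X$ homeomorphic to $2^{\mathbb{N}}$, that is both a partial transversal of $E$ and an $R$-clique. -/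

import Mathlib

/-- A subset of a topological space is co-analytic if its complement is analytic. -/
def IsCoanalytic {X : Type*} [TopologicalSpace X] (s : Set X) : Prop :=
  MeasureTheory.AnalyticSet sᶜ

/-- `Y` is an `R`-clique if `R x y` for all distinct `x, y ∈ Y`. -/
def IsRClique {X : Type*} (R : X → X → Prop) (Y : Set X) : Prop :=
  ∀ x ∈ Y, ∀ y ∈ Y, x ≠ y → R x y

/-- `Y` is a partial transversal of `E` if it contains no two distinct `E`-related points. -/
def IsPartialTransversal {X : Type*} (E : Setoid X) (Y : Set X) : Prop :=
  ∀ x ∈ Y, ∀ y ∈ Y, x ≠ y → ¬ E x y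

/-- A Cantor set is a homeomorphic copy (in the subspace topology) of the Cantor space. -/
def IsCantorSet {X : Type*} [TopologicalSpace X] (C : Set X) : Prop :=
  Nonempty (C ≃ₜ (ℕ → Bool))

open Set Filter Topology MeasureTheory

/-! Let a continuous `g` map Baire space onto the complement of `E`, and choose an uncountable set
`P` of codes whose points `(g a).1` lie in the clique and are pairwise inequivalent. For distinct a,
b in `P`, inequivalence has a witness w with `g w = ((g a).1, (g b).1)`, a closed condition on (a,
b, w).

As in the G₀ dichotomy, a fusion (`exists_continuous_edges_of_not_countable`) turns `P` into a
continuous map of Cantor space. All pairs of values satisfy the open conditions defining `R`, but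
witnesses are kept only along sparse edges flipping one coordinate: each doubling of the vertices
adds a single witness.

The pullback of `E` has the Baire property and contains no edge, so it is meagre
(`compl_mem_residual_of_flip`). Mycielski's theorem then finds a copy of Cantor space on which
distinct points are inequivalent. -/

/-! ### Finite approximations and limits -/

/-- The first `n` terms of a binary sequence. -/
def binaryTake (n : ℕ) (x : ℕ → Bool) : Fin n → Bool := fun i => x i

theorem continuous_binaryTake (n : ℕ) : Continuous (binaryTake n) :=
  continuous_pi fun _ => continuous_apply _

theorem init_binaryTake (n : ℕ) (x : ℕ → Bool) :
    Fin.init (binaryTake (n + 1) x) = binaryTake n x := rfl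

theorem binaryTake_last (n : ℕ) (x : ℕ → Bool) : binaryTake (n + 1) x (Fin.last n) = x n := rfl

theorem binaryTake_congr {n : ℕ} {x y : ℕ → Bool} (h : ∀ i < n, x i = y i) :
    binaryTake n x = binaryTake n y := funext fun i => h i i.2

theorem exists_seq_of_step {S : ℕ → Type*} (r : ∀ n, S n → S (n + 1) → Prop) (s₀ : S 0)
    (h : ∀ n s, ∃ t, r n s t) : ∃ f : ∀ n, S n, ∀ n, r n (f n) (f (n + 1)) := by
  choose g hg using h
  exact ⟨fun n => Nat.rec s₀ g n, fun n => hg _ _⟩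

/-- A coherent sequence of finite approximations converges to a continuous map on Cantor space. -/
theorem exists_continuous_limit {α : Type*} [TopologicalSpace α] [DiscreteTopology α]
    (c : ∀ n, (Fin n → Bool) → ℕ → α) (m : ℕ → ℕ) (N : ℕ) (hm : ∀ n, n ≤ m n)
    (h : ∀ n ≥ N, ∀ n' ≥ n, ∀ x, ∀ i < m n,
      c n' (binaryTake n' x) i = c n (binaryTake n x) i) :
    ∃ L : (ℕ → Bool) → ℕ → α, Continuous L ∧
      ∀ n ≥ N, ∀ x, ∀ i < m n, L x i = c n (binaryTake n x) i := by
  refine ⟨fun x i => c (max N (i + 1)) (binaryTake _ x) i, ?_, ?_⟩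
  · refine continuous_pi fun i => ?_
    exact (continuous_of_discreteTopology
      (f := fun s : Fin (max N (i + 1)) → Bool => c (max N (i + 1)) s i)).comp
      (continuous_binaryTake _)
  · intro n hn x i hi
    have hK : i < m (max N (i + 1)) := lt_of_lt_of_le (by omega) (hm _)
    change c (max N (i + 1)) (binaryTake _ x) i = _
    rw [← h n hn (max n (max N (i + 1))) (by omega) x i hi,
      ← h _ (by omega) (max n (max N (i + 1))) (by omega) x i hK]

theorem exists_cylinder_subset {α : Type*} [TopologicalSpace α] [DiscreteTopology α]
    {x : ℕ → α} {U : Set (ℕ → α)} (hU : U ∈ 𝓝 x) :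
    ∃ m : ℕ, ∀ y : ℕ → α, (∀ i < m, y i = x i) → y ∈ U := by
  obtain ⟨V, hV, hxV, hVU⟩ :=
    (PiNat.isTopologicalBasis_cylinders (fun _ : ℕ => α)).mem_nhds_iff.1 hU
  obtain ⟨z, n, rfl⟩ := hV
  refine ⟨n, fun y hy => hVU ?_⟩
  rw [PiNat.mem_cylinder_iff_eq.1 hxV |>.symm]
  exact hy

theorem exists_cylinder_prod_subset {α : Type*} [TopologicalSpace α] [DiscreteTopology α]
    {x y : ℕ → α} {U : Set ((ℕ → α) × (ℕ → α))} (hU : U ∈ 𝓝 (x, y)) :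
    ∃ m : ℕ, ∀ m' ≥ m, ∀ a b : ℕ → α, (∀ i < m', a i = x i) → (∀ i < m', b i = y i) →
      (a, b) ∈ U := by
  obtain ⟨u, hu, v, hv, huv⟩ := mem_nhds_prod_iff.1 hU
  obtain ⟨m, hm⟩ := exists_cylinder_subset hu
  obtain ⟨n, hn⟩ := exists_cylinder_subset hv
  exact ⟨max m n, fun m' hm' a b ha hb => huv ⟨hm a fun i hi => ha i (by omega),
    hn b fun i hi => hb i (by omega)⟩⟩

theorem exists_cylinder_prod_subset_of_finite {α ι : Type*} [TopologicalSpace α]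
    [DiscreteTopology α] [Finite ι] {x y : ι → ℕ → α} {U : ι → Set ((ℕ → α) × (ℕ → α))}
    (hU : ∀ i, U i ∈ 𝓝 (x i, y i)) (m₀ : ℕ) :
    ∃ m ≥ m₀, ∀ k, ∀ a b : ℕ → α, (∀ i < m, a i = x k i) → (∀ i < m, b i = y k i) →
      (a, b) ∈ U k := by
  choose m hm using fun k => exists_cylinder_prod_subset (hU k)
  obtain ⟨M, hM⟩ := Finite.bddAbove_range m
  exact ⟨max m₀ M, le_max_left _ _, fun k =>
    hm k _ ((hM ⟨k, rfl⟩).trans (le_max_right _ _))⟩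

/-! ### Mycielski's theorem -/

/-- **Mycielski's theorem** for binary relations on Cantor space. -/
theorem exists_continuous_pairwise_mem_of_residual
    {S : Set ((ℕ → Bool) × (ℕ → Bool))} (hS : S ∈ residual _) :
    ∃ f : (ℕ → Bool) → ℕ → Bool, Continuous f ∧ ∀ x y, x ≠ y → (f x, f y) ∈ S := by
  obtain ⟨D, hDo, hDd, hDS⟩ : ∃ D : ℕ → Set ((ℕ → Bool) × (ℕ → Bool)),
      (∀ n, IsOpen (D n)) ∧ (∀ n, Dense (D n)) ∧ ⋂ n, D n ⊆ S := by
    obtain ⟨𝒟, h1, h2, h3, h4⟩ := mem_residual_iff.1 hS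
    obtain ⟨D, hD⟩ := (h3.insert univ).exists_eq_range (insert_nonempty _ _)
    have hmem : ∀ n, D n ∈ insert univ 𝒟 := fun n => hD ▸ mem_range_self n
    refine ⟨D, fun n => ?_, fun n => ?_, fun p hp => h4 ?_⟩
    · rcases hmem n with h | h
      · rw [h]; exact isOpen_univ
      · exact h1 _ h
    · rcases hmem n with h | h
      · rw [h]; exact dense_univ
      · exact h2 _ h
    · intro t ht
      obtain ⟨n, rfl⟩ : t ∈ range D := hD ▸ mem_insert_of_mem _ ht
      exact mem_iInter.1 hp n
  have hres : ∀ n : ℕ, {c : (Fin n → Bool) → ℕ → Bool |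
      ∀ s t, s ≠ t → ∀ k, (c s, c t) ∈ D k} ∈ residual _ := by
    intro n
    have key : ∀ s t : Fin n → Bool, s ≠ t → ∀ k,
        {c : (Fin n → Bool) → ℕ → Bool | (c s, c t) ∈ D k} ∈ residual _ := by
      intro s t hst k
      have hc : Continuous fun c : (Fin n → Bool) → ℕ → Bool => (c s, c t) := by fun_prop
      refine residual_of_dense_open ((hDo k).preimage hc) ?_
      refine (hDd k).preimage ?_
      rw [isOpenMap_iff_nhds_le]
      intro c V hV
      rw [mem_map, nhds_pi, Filter.mem_pi] at hV
      obtain ⟨I, -, v, hv, hvV⟩ := hV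
      refine mem_nhds_prod_iff.2 ⟨v s, hv s, v t, hv t, ?_⟩
      rintro ⟨a, b⟩ ⟨ha, hb⟩
      have hmem : Function.update (Function.update c s a) t b ∈ I.pi v := by
        intro i _
        by_cases hit : i = t
        · subst hit; simpa using hb
        by_cases his : i = s
        · subst his; simpa [hit] using ha
        · simpa [hit, his] using mem_of_mem_nhds (hv i)
      simpa [hst] using hvV hmem
    have : {c : (Fin n → Bool) → ℕ → Bool | ∀ s t, s ≠ t → ∀ k, (c s, c t) ∈ D k}
        = ⋂ s, ⋂ t, ⋂ k, {c | s ≠ t → (c s, c t) ∈ D k} := by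
      ext c; simp only [mem_ofPred_eq, mem_iInter]; tauto
    rw [this]
    simp only [countable_iInter_mem]
    intro s t k
    by_cases hst : s = t
    · simp [hst]
    · filter_upwards [key s t hst k] with c hc _ using hc
  -- A state is a tuple with a number of digits that already forces the first conditions on all
  -- distinct pairs.
  let St : ℕ → Type := fun n => {p : ((Fin n → Bool) → ℕ → Bool) × ℕ //
    n ≤ p.2 ∧ ∀ s t, s ≠ t → ∀ k ≤ n, ∀ a b : ℕ → Bool, (∀ i < p.2, a i = p.1 s i) →
      (∀ i < p.2, b i = p.1 t i) → (a, b) ∈ D k}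
  have refine_state : ∀ n m₀, ∀ V : Set ((Fin n → Bool) → ℕ → Bool), IsOpen V → V.Nonempty →
      ∃ p : St n, p.1.1 ∈ V ∧ m₀ ≤ p.1.2 := by
    intro n m₀ V hV hVne
    obtain ⟨c, hcV, hc⟩ := (dense_of_mem_residual (hres n)).inter_open_nonempty V hV hVne
    obtain ⟨m, hm, hmc⟩ := exists_cylinder_prod_subset_of_finite
      (ι := {q : (Fin n → Bool) × (Fin n → Bool) // q.1 ≠ q.2} × Fin (n + 1))
      (x := fun q => c q.1.1.1) (y := fun q => c q.1.1.2) (U := fun q => D q.2)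
      (fun q => (hDo _).mem_nhds (hc _ _ q.1.2 _)) (max n m₀)
    exact ⟨⟨(c, m), (le_max_left _ _).trans hm, fun s t hst k hk =>
      hmc ⟨⟨(s, t), hst⟩, ⟨k, by omega⟩⟩⟩, hcV, (le_max_right _ _).trans hm⟩
  obtain ⟨s₀, -, -⟩ := refine_state 0 0 univ isOpen_univ univ_nonempty
  obtain ⟨f, hf⟩ := exists_seq_of_step (S := St) (fun n p q => p.1.2 ≤ q.1.2 ∧
      ∀ s, ∀ i < p.1.2, q.1.1 s i = p.1.1 (Fin.init s) i) s₀ (by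
    intro n p
    obtain ⟨q, hq, hm⟩ := refine_state (n + 1) p.1.2
      {c | ∀ s, ∀ i < p.1.2, c s i = p.1.1 (Fin.init s) i} (by
        have : {c : (Fin (n + 1) → Bool) → ℕ → Bool |
            ∀ s, ∀ i < p.1.2, c s i = p.1.1 (Fin.init s) i}
            = ⋂ s, ⋂ i : Fin p.1.2, {c | c s i = p.1.1 (Fin.init s) i} := by
          ext c
          simp only [mem_ofPred_eq, mem_iInter]
          exact ⟨fun h s i => h s i i.2, fun h s i hi => h s ⟨i, hi⟩⟩
        rw [this]
        refine isOpen_iInter_of_finite fun s => isOpen_iInter_of_finite fun i => ?_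
        exact (isOpen_discrete {p.1.1 (Fin.init s) i}).preimage
          (f := fun c : (Fin (n + 1) → Bool) → ℕ → Bool => c s i) (by fun_prop))
      ⟨fun s => p.1.1 (Fin.init s), fun _ _ _ => rfl⟩
    exact ⟨q, hm, hq⟩)
  have hmono : Monotone fun n => (f n).1.2 := monotone_nat_of_le_succ fun n => (hf n).1
  obtain ⟨L, hL, hLf⟩ := exists_continuous_limit (fun n => (f n).1.1) (fun n => (f n).1.2) 0
    (fun n => (f n).2.1) (by
      intro n _ n' hn' x i hi
      induction n', hn' using Nat.le_induction with
      | base => rfl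
      | succ k hk ih => rw [← ih, (hf k).2 _ i (lt_of_lt_of_le hi (hmono hk)), init_binaryTake])
  refine ⟨L, hL, fun x y hxy => hDS (mem_iInter.2 fun k => ?_)⟩
  obtain ⟨j, hj⟩ := Function.ne_iff.1 hxy
  refine (f (max k (j + 1))).2.2 (binaryTake _ x) (binaryTake _ y) ?_ k (le_max_left _ _) _ _
    (hLf _ (Nat.zero_le _) x) (hLf _ (Nat.zero_le _) y)
  exact fun h => hj (congrFun h ⟨j, by omega⟩)

/-! ### The Baire property of analytic sets -/

/-- Every set has a largest open set, up to a meagre set, in which it is meagre. -/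
theorem exists_isOpen_meagre_inter {Z : Type*} [TopologicalSpace Z] [SecondCountableTopology Z]
    (A : Set Z) : ∃ O : Set Z, IsOpen O ∧ IsMeagre (A ∩ O) ∧
      ∀ U, IsOpen U → IsMeagre (A ∩ U) → U ⊆ O := by
  have hB := TopologicalSpace.isBasis_countableBasis Z
  refine ⟨⋃ V ∈ {V ∈ TopologicalSpace.countableBasis Z | IsMeagre (A ∩ V)}, V,
    isOpen_biUnion fun V hV => hB.isOpen hV.1, ?_, ?_⟩
  · rw [inter_iUnion₂]
    exact isMeagre_biUnion ((TopologicalSpace.countable_countableBasis Z).mono fun _ h => h.1)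
      fun V hV => hV.2
  · intro U hU hAU x hx
    obtain ⟨V, hV, hxV, hVU⟩ := hB.exists_subset_of_mem_open hx hU
    exact mem_biUnion (x := V) ⟨hV, hAU.mono (inter_subset_inter_right _ hVU)⟩ hxV

/-- Analytic sets have the property of Baire. -/
theorem MeasureTheory.AnalyticSet.baireMeasurableSet {Z : Type*} [TopologicalSpace Z] [T2Space Z]
    [SecondCountableTopology Z] {A : Set Z} (hA : AnalyticSet A) : BaireMeasurableSet A := by
  rw [AnalyticSet] at hA
  rcases hA with rfl | ⟨g, hg, rfl⟩
  · exact isOpen_empty.baireMeasurableSet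
  let C : List ℕ → Set (ℕ → ℕ) := fun s => {f | PiNat.res f s.length = s}
  have hC : ∀ s, C s = ⋃ n, C (n :: s) := by
    intro s
    ext f
    simp [C, PiNat.res_succ]
  choose O hO hOm hOmax using fun s => exists_isOpen_meagre_inter (g '' C s)
  -- The complement of `O s` acts as a closed hull of `g '' C s`. Up to a meagre set, the hulls of
  -- the children cover the hull of `s`, so a generic point of the root hull follows a branch.
  have hbad : ∀ s, IsMeagre ((⋂ n, O (n :: s)) \ O s) := by
    intro s
    borelize Z
    obtain ⟨U, hU, hPU⟩ := MeasurableSet.residualEq_isOpen (s := (⋂ n, O (n :: s)) \ O s)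
      ((MeasurableSet.iInter fun n => (hO _).measurableSet).diff (hO s).measurableSet)
    have hUO : U ⊆ O s := by
      refine hOmax s U hU ?_
      rw [hC, image_iUnion, iUnion_inter]
      refine isMeagre_iUnion fun n => ?_
      have h := hOm (n :: s)
      rw [IsMeagre] at h ⊢
      filter_upwards [h, hPU.mem_iff] with z hz hz' hzU
      exact hz ⟨hzU.1, mem_iInter.1 (hz'.2 hzU.2).1 n⟩
    rw [IsMeagre]
    filter_upwards [hPU.mem_iff] with z hz hz'
    exact hz'.2 (hUO (hz.1 hz'))
  have hbranch : ∀ z, z ∉ O [] → (∀ s, z ∉ (⋂ n, O (n :: s)) \ O s) → z ∈ range g := by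
    intro z hz0 hz
    have hstep : ∀ s : {s // z ∉ O s}, ∃ n, z ∉ O (n :: s.1) := by
      rintro ⟨s, hs⟩
      by_contra! hcon
      exact hz s ⟨mem_iInter.2 hcon, hs⟩
    choose nx hnx using hstep
    let l : ℕ → {s // z ∉ O s} := fun k => Nat.rec ⟨[], hz0⟩ (fun _ s => ⟨nx s :: s.1, hnx s⟩) k
    let f : ℕ → ℕ := fun k => nx (l k)
    have hl : ∀ k, PiNat.res f k = (l k).1 := by
      intro k
      induction k with
      | zero => rfl
      | succ k ih => rw [PiNat.res_succ, ih]
    refine ⟨f, ?_⟩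
    by_contra hne
    obtain ⟨V, U, hV, hU, hfV, hzU, hVU⟩ := t2_separation hne
    obtain ⟨k, hk⟩ := exists_cylinder_subset ((hV.preimage hg).mem_nhds hfV)
    refine (l k).2 (hOmax _ U hU ?_ hzU)
    convert! IsMeagre.empty
    rw [← disjoint_iff_inter_eq_empty]
    refine hVU.mono_left ?_
    rintro _ ⟨y, hy, rfl⟩
    refine hk y fun i hi => ?_
    have hy' : PiNat.res y (l k).1.length = PiNat.res f k := (hy : _ = _).trans (hl k).symm
    have hlen : (l k).1.length = k := by rw [← hl, PiNat.res_length]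
    rw [hlen, PiNat.res_eq_res] at hy'
    exact hy' hi
  refine (hO []).isClosed_compl.isOpen_compl.baireMeasurableSet.compl.congr ?_
  have h0 : IsMeagre (range g ∩ O []) := by
    convert! hOm []
    ext; simp [C]
  have hall : ∀ᶠ z in residual Z, ∀ s, z ∉ (⋂ n, O (n :: s)) \ O s :=
    eventually_countable_forall.2 hbad
  rw [eventuallyEq_set]
  filter_upwards [h0, hall] with z hz hz'
  rw [compl_compl]
  exact ⟨fun h => hbranch z h hz', fun h h' => hz ⟨h, h'⟩⟩

/-! ### Category in products and meagre equivalence relations -/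

/-- The easy half of the **Kuratowski–Ulam theorem**. -/
theorem eventually_residual_of_prod {X Y : Type*} [TopologicalSpace X] [TopologicalSpace Y]
    [SecondCountableTopology Y] {S : Set (X × Y)} (hS : S ∈ residual (X × Y)) :
    ∀ᶠ x in residual X, ∀ᶠ y in residual Y, (x, y) ∈ S := by
  obtain ⟨𝒟, hDo, hDd, hDc, hDS⟩ := mem_residual_iff.1 hS
  have key : ∀ D ∈ 𝒟, ∀ᶠ x in residual X, ∀ᶠ y in residual Y, (x, y) ∈ D := by
    intro D hD
    have hB := TopologicalSpace.isBasis_countableBasis Y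
    have hV : ∀ V ∈ TopologicalSpace.countableBasis Y, ∀ᶠ x in residual X,
        ∃ y ∈ V, (x, y) ∈ D := by
      intro V hV
      have hVne := TopologicalSpace.nonempty_of_mem_countableBasis hV
      have heq : {x | ∃ y ∈ V, (x, y) ∈ D} = Prod.fst '' (D ∩ univ ×ˢ V) := by
        ext x
        simp [and_comm]
      refine residual_of_dense_open ?_ ?_
      · rw [heq]
        exact isOpenMap_fst _ ((hDo D hD).inter (isOpen_univ.prod (hB.isOpen hV)))
      · rw [dense_iff_inter_open]
        intro U hU hUne
        obtain ⟨⟨x, y⟩, ⟨hx, hy⟩, hxy⟩ := (hDd D hD).inter_open_nonempty (U ×ˢ V)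
          (hU.prod (hB.isOpen hV)) (hUne.prod hVne)
        exact ⟨x, hx, y, hy, hxy⟩
    have := (eventually_countable_ball (TopologicalSpace.countable_countableBasis Y)).2 hV
    filter_upwards [this] with x hx
    refine residual_of_dense_open ((hDo D hD).preimage (by fun_prop : Continuous (Prod.mk x))) ?_
    rw [hB.dense_iff]
    intro V hV hVne
    obtain ⟨y, hy, hxy⟩ := hx V hV
    exact ⟨y, hy, hxy⟩
  filter_upwards [(eventually_countable_ball hDc).2 key] with x hx
  filter_upwards [(eventually_countable_ball hDc).2 hx] with y hy
  exact hDS fun D hD => hy D hD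

/-- Negation of the `n`-th term of a binary sequence. -/
def binaryFlip (n : ℕ) (x : ℕ → Bool) : ℕ → Bool := Function.update x n (!x n)

theorem binaryFlip_involutive (n : ℕ) : Function.Involutive (binaryFlip n) := by
  intro x
  simp [binaryFlip]

theorem continuous_binaryFlip (n : ℕ) : Continuous (binaryFlip n) :=
  continuous_id.update n
    ((continuous_of_discreteTopology (f := not)).comp (continuous_apply n))

theorem isOpenMap_binaryFlip (n : ℕ) : IsOpenMap (binaryFlip n) :=
  ((Homeomorph.mk (binaryFlip_involutive n).toPerm (continuous_binaryFlip n)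
    (continuous_binaryFlip n))).isOpenMap

/-- An equivalence relation on Cantor space with the Baire property, none of whose classes contains
both endpoints of an edge from a dense family, is meagre. -/
theorem compl_mem_residual_of_flip (E : Setoid (ℕ → Bool))
    (hE : BaireMeasurableSet {p : (ℕ → Bool) × (ℕ → Bool) | E p.1 p.2})
    (e : ℕ → ℕ → Bool) (he : ∀ (x : ℕ → Bool) m, ∃ n ≥ m, ∀ i < m, e n i = x i)
    (hflip : ∀ n (x : ℕ → Bool), (∀ i < n, x i = e n i) →
      ¬ E (Function.update x n false) (Function.update x n true)) :
    {p : (ℕ → Bool) × (ℕ → Bool) | ¬ E p.1 p.2} ∈ residual _ := by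
  obtain ⟨W, hW, hEW⟩ := hE.residualEq_isOpen
  rcases W.eq_empty_or_nonempty with rfl | ⟨⟨u, v⟩, huv⟩
  · filter_upwards [hEW.mem_iff] with p hp h
    exact hp.1 h
  -- Otherwise `E` is comeagre in a box. For generic `x`, a generic `y` near a vertex `e n` and its
  -- flip at `n` are both related to `x`, hence to each other: an edge inside a class.
  exfalso
  obtain ⟨U, hU, V, hV, hUV⟩ := mem_nhds_prod_iff.1 (hW.mem_nhds huv)
  have hres : {p : (ℕ → Bool) × (ℕ → Bool) | p ∈ W → E p.1 p.2} ∈ residual _ := by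
    filter_upwards [hEW.mem_iff] with p hp using hp.2
  obtain ⟨x, hx, hxU⟩ := (dense_of_mem_residual
    (eventually_residual_of_prod hres)).inter_nhds_nonempty hU
  obtain ⟨m, hm⟩ := exists_cylinder_subset hV
  obtain ⟨n, hmn, hn⟩ := he v m
  have hx' : ∀ᶠ y in residual (ℕ → Bool), (x, y) ∈ W → E x y := hx
  have hx2 := (tendsto_residual_of_isOpenMap (continuous_binaryFlip n)
    (isOpenMap_binaryFlip n)).eventually hx'
  have hcyl : {y : ℕ → Bool | ∀ i < n, y i = e n i} ∈ 𝓝 (e n) :=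
    (PiNat.isOpen_cylinder (fun _ => Bool) (e n) n).mem_nhds (PiNat.self_mem_cylinder _ _)
  obtain ⟨y, ⟨hy1, hy2⟩, hyn⟩ :=
    (dense_of_mem_residual (hx'.and hx2)).inter_nhds_nonempty hcyl
  have hyV : ∀ z : ℕ → Bool, (∀ i < n, z i = y i) → (x, z) ∈ W := fun z hz =>
    hUV ⟨hxU, hm z fun i hi => by
      rw [hz i (by omega), hyn i (by omega), hn i hi]⟩
  have h1 := hy1 (hyV y fun _ _ => rfl)
  have h2 := hy2 (hyV (binaryFlip n y) fun i hi => by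
    simp [binaryFlip, Function.update_of_ne (by omega : i ≠ n)])
  refine hflip n y hyn ?_
  have h3 := E.trans (E.symm h1) h2
  have h4 : Function.update y n (y n) = y := Function.update_eq_self n y
  unfold binaryFlip at h3
  cases hb : y n <;> rw [hb] at h3 h4
  · rw [h4]; exact h3
  · rw [h4]; exact E.symm h3

/-! ### Large sets of configurations and fusion -/

/-- A finite configuration of level `n`: the entry `0` places the `2 ^ n` vertices in Baire space,
the entry `k + 1` provides the witnesses for the edges flipping the coordinate `k`. -/
abbrev Configuration (n : ℕ) : Type := ℕ → (Fin n → Bool) → ℕ → ℕ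

/-- A set of configurations is large over `P` if no countable set meets the vertex sets of all its
members with vertices in `P`. -/
def IsLarge (P : Set (ℕ → ℕ)) {n : ℕ} (W : Set (Configuration n)) : Prop :=
  ∀ Z : Set (ℕ → ℕ), Z.Countable → ∃ c ∈ W, ∀ s, c 0 s ∈ P ∧ c 0 s ∉ Z

/-- Non-large sets form a σ-ideal: countably many countable obstructions unite to one. -/
theorem IsLarge.exists_of_countable {P : Set (ℕ → ℕ)} {n : ℕ} {W : Set (Configuration n)}
    (hW : IsLarge P W) {ι : Type*} [Countable ι] (r : Configuration n → ι → Prop)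
    (hr : ∀ c ∈ W, (∀ s, c 0 s ∈ P) → ∃ i, r c i) : ∃ i, IsLarge P {c ∈ W | r c i} := by
  by_contra! hcon
  have h : ∀ i, ∃ Z : Set (ℕ → ℕ), Z.Countable ∧
      ∀ c ∈ W, r c i → ∃ s, c 0 s ∈ P → c 0 s ∈ Z := by
    intro i
    have := hcon i
    simp only [IsLarge, not_forall, not_exists, not_and] at this
    obtain ⟨Z, hZ, h⟩ := this
    refine ⟨Z, hZ, fun c hc hci => ?_⟩
    obtain ⟨s, hs⟩ := h c ⟨hc, hci⟩
    exact ⟨s, fun hsP => not_not.1 (hs hsP)⟩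
  choose Z hZ hZc using h
  obtain ⟨c, hc, hcs⟩ := hW (⋃ i, Z i) (countable_iUnion hZ)
  obtain ⟨i, hi⟩ := hr c hc fun s => (hcs s).1
  obtain ⟨s, hs⟩ := hZc i c hc hi
  exact (hcs s).2 (mem_iUnion.2 ⟨i, hs (hcs s).1⟩)

theorem isLarge_univ_zero {P : Set (ℕ → ℕ)} (hP : ¬ P.Countable) :
    IsLarge P (univ : Set (Configuration 0)) := by
  intro Z hZ
  obtain ⟨a, haP, haZ⟩ := not_subset.1 fun h => hP (hZ.mono h)
  exact ⟨fun _ _ => a, mem_univ _, fun _ => ⟨haP, haZ⟩⟩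

/-- Two configurations of level `n` and a witness joined to a configuration of level `n + 1`. -/
def amalgam {n : ℕ} (c₀ c₁ : Configuration n) (w : ℕ → ℕ) : Configuration (n + 1) := fun j s =>
  if j = n + 1 then w else if s (Fin.last n) then c₁ j (Fin.init s) else c₀ j (Fin.init s)

/-- The amalgams of members of `W` whose new edge, at the vertex `e`, lies in `T`. -/
def amalgams (T : Set ((ℕ → ℕ) × (ℕ → ℕ) × (ℕ → ℕ))) {n : ℕ} (e : Fin n → Bool)
    (W : Set (Configuration n)) : Set (Configuration (n + 1)) :=
  {c | ∃ c₀ ∈ W, ∃ c₁ ∈ W, ∃ w, (c₀ 0 e, c₁ 0 e, w) ∈ T ∧ c = amalgam c₀ c₁ w}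

/-- Choosing `c₁` off the vertices of `c₀` makes the endpoints of the new edge distinct, so a
witness exists. -/
theorem IsLarge.amalgams {P : Set (ℕ → ℕ)} {T : Set ((ℕ → ℕ) × (ℕ → ℕ) × (ℕ → ℕ))}
    (hT : ∀ a ∈ P, ∀ b ∈ P, a ≠ b → ∃ w, (a, b, w) ∈ T) {n : ℕ} (e : Fin n → Bool)
    {W : Set (Configuration n)} (hW : IsLarge P W) : IsLarge P (amalgams T e W) := by
  intro Z hZ
  obtain ⟨c₀, hc₀, h₀⟩ := hW Z hZ
  obtain ⟨c₁, hc₁, h₁⟩ := hW (Z ∪ range (c₀ 0)) (hZ.union (countable_range _))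
  obtain ⟨w, hw⟩ := hT _ (h₀ e).1 _ (h₁ e).1 fun h => (h₁ e).2 (Or.inr ⟨e, h⟩)
  refine ⟨amalgam c₀ c₁ w, ⟨c₀, hc₀, c₁, hc₁, w, hw, rfl⟩, fun s => ?_⟩
  by_cases hs : s (Fin.last n) = true
  · simpa [amalgam, hs] using ⟨(h₁ _).1, fun h => (h₁ (Fin.init s)).2 (Or.inl h)⟩
  · simpa [amalgam, hs] using h₀ (Fin.init s)

/-- The configuration `c` has its edges, along the vertices `e k`, in `T`. -/
def HasEdges (T : Set ((ℕ → ℕ) × (ℕ → ℕ) × (ℕ → ℕ))) (e : ℕ → ℕ → Bool) {n : ℕ}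
    (c : Configuration n) : Prop :=
  ∀ k < n, ∀ x : ℕ → Bool, (∀ i < k, x i = e k i) →
    (c 0 (binaryTake n (Function.update x k false)), c 0 (binaryTake n (Function.update x k true)),
      c (k + 1) (binaryTake n x)) ∈ T

/-- An edge flipping `k < n` stays within one half; the only edge between the halves is the new one.
-/
theorem HasEdges.amalgams {T : Set ((ℕ → ℕ) × (ℕ → ℕ) × (ℕ → ℕ))} {e : ℕ → ℕ → Bool} {n : ℕ}
    {W : Set (Configuration n)} (hW : ∀ c ∈ W, HasEdges T e c) :
    ∀ c ∈ amalgams T (binaryTake n (e n)) W, HasEdges T e c := by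
  rintro _ ⟨c₀, hc₀, c₁, hc₁, w, hw, rfl⟩ k hk x hx
  rcases Nat.lt_succ_iff_lt_or_eq.1 hk with hkn | rfl
  · have hne : n ≠ k := by omega
    have hne' : k ≠ n := by omega
    simp only [amalgam, init_binaryTake, binaryTake_last, Function.update_of_ne hne,
      Nat.add_right_cancel_iff, hne', if_false, (Nat.succ_ne_zero n).symm]
    by_cases hxn : x n = true
    · simpa [hxn] using hW c₁ hc₁ k hkn x hx
    · simpa [hxn] using hW c₀ hc₀ k hkn x hx
  · have h : ∀ b, binaryTake k (Function.update x k b) = binaryTake k (e k) := fun b =>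
      binaryTake_congr fun i hi => by rw [Function.update_of_ne (by omega), hx i hi]
    simpa [amalgam, init_binaryTake, binaryTake_last, h] using hw

/-- A large set `W` of configurations with edges in `T` that agree on `m` digits, in such a way that
these digits guarantee that all pairs of vertices are in `U k` for `k ≤ n`. -/
structure FusionStage (P : Set (ℕ → ℕ)) (T : Set ((ℕ → ℕ) × (ℕ → ℕ) × (ℕ → ℕ)))
    (U : ℕ → Set ((ℕ → ℕ) × (ℕ → ℕ))) (e : ℕ → ℕ → Bool) (n : ℕ) where
  W : Set (Configuration n)
  m : ℕ
  large : IsLarge P W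
  le_m : n ≤ m
  agree : ∀ c ∈ W, ∀ c' ∈ W, ∀ j ≤ n, ∀ s, ∀ i < m, c j s i = c' j s i
  edges : ∀ c ∈ W, HasEdges T e c
  pairs : ∀ c ∈ W, ∀ s t, ∀ k ≤ n, ∀ a b : ℕ → ℕ, (∀ i < m, a i = c 0 s i) →
    (∀ i < m, b i = c 0 t i) → (a, b) ∈ U k

/-- There are countably many choices for the number of digits, then for the digits themselves, so
some choice keeps the set large. -/
theorem IsLarge.exists_fusionStage {P : Set (ℕ → ℕ)} {T : Set ((ℕ → ℕ) × (ℕ → ℕ) × (ℕ → ℕ))}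
    {U : ℕ → Set ((ℕ → ℕ) × (ℕ → ℕ))} {e : ℕ → ℕ → Bool} (hU : ∀ k, IsOpen (U k))
    (hPU : ∀ a ∈ P, ∀ b ∈ P, ∀ k, (a, b) ∈ U k) {n : ℕ} {W : Set (Configuration n)}
    (hW : IsLarge P W) (hedges : ∀ c ∈ W, HasEdges T e c) :
    ∃ q : FusionStage P T U e n, q.W ⊆ W := by
  obtain ⟨m, hm⟩ := hW.exists_of_countable
    (fun c m => n ≤ m ∧ ∀ s t, ∀ k ≤ n, ∀ a b : ℕ → ℕ, (∀ i < m, a i = c 0 s i) →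
      (∀ i < m, b i = c 0 t i) → (a, b) ∈ U k) (by
    intro c _ hcP
    obtain ⟨m, hm, hmc⟩ := exists_cylinder_prod_subset_of_finite
      (ι := (Fin n → Bool) × (Fin n → Bool) × Fin (n + 1))
      (x := fun q => c 0 q.1) (y := fun q => c 0 q.2.1) (U := fun q => U q.2.2)
      (fun q => (hU _).mem_nhds (hPU _ (hcP _) _ (hcP _) _)) n
    exact ⟨m, hm, fun s t k hk => hmc (s, t, ⟨k, by omega⟩)⟩)
  obtain ⟨d, hd⟩ := hm.exists_of_countable
    (fun c (d : Fin (n + 1) → (Fin n → Bool) → Fin m → ℕ) =>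
      ∀ (j : Fin (n + 1)) s (i : Fin m), c j s i = d j s i)
    fun c _ _ => ⟨fun j s i => c j s i, fun _ _ _ => rfl⟩
  obtain ⟨c, hc, -⟩ := hd ∅ countable_empty
  exact ⟨⟨_, m, hd, hc.1.2.1, fun c hc c' hc' j hj s i hi =>
    (hc.2 ⟨j, by omega⟩ s ⟨i, hi⟩).trans (hc'.2 ⟨j, by omega⟩ s ⟨i, hi⟩).symm,
    fun c hc => hedges c hc.1.1, fun c hc => hc.1.2.2⟩, fun c hc => hc.1.1⟩

/-- An uncountable set `P`, whose pairs of distinct points are in the projection of the closed set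
`T` and whose pairs are in all open sets `U k`, gives rise to a continuous map on Cantor space whose
pairs of values are in all `U k` and that maps the edges along the vertices `e n` into the projection
of `T`. -/
theorem exists_continuous_edges_of_not_countable {P : Set (ℕ → ℕ)} (hP : ¬ P.Countable)
    {T : Set ((ℕ → ℕ) × (ℕ → ℕ) × (ℕ → ℕ))} (hTc : IsClosed T)
    (hT : ∀ a ∈ P, ∀ b ∈ P, a ≠ b → ∃ w, (a, b, w) ∈ T)
    {U : ℕ → Set ((ℕ → ℕ) × (ℕ → ℕ))} (hU : ∀ k, IsOpen (U k))
    (hPU : ∀ a ∈ P, ∀ b ∈ P, ∀ k, (a, b) ∈ U k) (e : ℕ → ℕ → Bool) :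
    ∃ φ : (ℕ → Bool) → ℕ → ℕ, Continuous φ ∧ (∀ x y k, (φ x, φ y) ∈ U k) ∧
      ∀ n (x : ℕ → Bool), (∀ i < n, x i = e n i) →
        ∃ w, (φ (Function.update x n false), φ (Function.update x n true), w) ∈ T := by
  obtain ⟨q₀, -⟩ := (isLarge_univ_zero hP).exists_fusionStage (T := T) (e := e) hU hPU
    fun c _ k hk => absurd hk (Nat.not_lt_zero k)
  obtain ⟨q, hq⟩ := exists_seq_of_step (S := FusionStage P T U e)
    (fun n p q => q.W ⊆ amalgams T (binaryTake n (e n)) p.W) q₀ fun n p =>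
      (p.large.amalgams hT _).exists_fusionStage hU hPU (HasEdges.amalgams p.edges)
  -- Along a branch, a later configuration restricts to a member of each earlier large set.
  have hdesc : ∀ n, ∀ n' ≥ n, ∀ c ∈ (q n').W, ∀ x, ∃ c' ∈ (q n).W, ∀ j ≤ n,
      c j (binaryTake n' x) = c' j (binaryTake n x) := by
    intro n n' hn'
    induction n', hn' using Nat.le_induction with
    | base => exact fun c hc x => ⟨c, hc, fun _ _ => rfl⟩
    | succ k hk ih =>
      intro c hc x
      obtain ⟨c₀, hc₀, c₁, hc₁, w, -, rfl⟩ := hq k hc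
      by_cases hx : x k = true
      · obtain ⟨c', hc', h⟩ := ih c₁ hc₁ x
        refine ⟨c', hc', fun j hj => ?_⟩
        have hjk : j ≠ k + 1 := by omega
        rw [← h j hj]
        simp [amalgam, binaryTake_last, init_binaryTake, hx, hjk]
      · obtain ⟨c', hc', h⟩ := ih c₀ hc₀ x
        refine ⟨c', hc', fun j hj => ?_⟩
        have hjk : j ≠ k + 1 := by omega
        rw [← h j hj]
        simp [amalgam, binaryTake_last, init_binaryTake, hx, hjk]
  have hne : ∀ n, ∃ c, c ∈ (q n).W := fun n =>
    let ⟨c, hc, _⟩ := (q n).large ∅ countable_empty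
    ⟨c, hc⟩
  choose c hc using hne
  have hlim := fun j => exists_continuous_limit (fun n => c n j) (fun n => (q n).m) j
    (fun n => (q n).le_m) (by
      intro n hn n' hn' x i hi
      obtain ⟨c', hc', h⟩ := hdesc n n' hn' (c n') (hc n') x
      rw [h j hn]
      exact (q n).agree c' hc' (c n) (hc n) j hn _ i hi)
  choose L hLc hL using hlim
  have htend : ∀ j x, Tendsto (fun n => c n j (binaryTake n x)) atTop (𝓝 (L j x)) := by
    intro j x
    refine tendsto_pi_nhds.2 fun i => tendsto_const_nhds.congr' ?_
    filter_upwards [eventually_ge_atTop (max j (i + 1))] with n hn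
    exact hL j n (by omega) x i (lt_of_lt_of_le (by omega) (q n).le_m)
  refine ⟨L 0, hLc 0, fun x y k => ?_, fun k x hx => ⟨L (k + 1) x, ?_⟩⟩
  -- The truncations may coincide; `pairs` includes the diagonal for this reason.
  · exact (q k).pairs (c k) (hc k) (binaryTake k x) (binaryTake k y) k le_rfl _ _
      (hL 0 k (Nat.zero_le _) x) (hL 0 k (Nat.zero_le _) y)
  · refine hTc.mem_of_tendsto ((htend 0 _).prodMk_nhds ((htend 0 _).prodMk_nhds (htend (k + 1) x))) ?_
    filter_upwards [eventually_gt_atTop k] with n hn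
    exact (q n).edges (c n) (hc n) k hn x hx

/-! ### Dense vertices, coding and conclusion -/

/-- Pairing repeats each term of a dense sequence at arbitrarily large indices. -/
theorem exists_dense_vertices :
    ∃ e : ℕ → ℕ → Bool, ∀ (x : ℕ → Bool) m, ∃ n ≥ m, ∀ i < m, e n i = x i := by
  refine ⟨fun n => TopologicalSpace.denseSeq (ℕ → Bool) n.unpair.1, fun x m => ?_⟩
  obtain ⟨_, hy, j, rfl⟩ := (TopologicalSpace.denseRange_denseSeq (ℕ → Bool)).inter_open_nonempty
    (PiNat.cylinder x m) (PiNat.isOpen_cylinder (fun _ => Bool) x m) ⟨x, PiNat.self_mem_cylinder _ _⟩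
  refine ⟨Nat.pair j m, Nat.right_le_pair j m, fun i hi => ?_⟩
  simp only [Nat.unpair_pair]
  exact hy i hi

theorem isCantorSet_range {X : Type*} [TopologicalSpace X] [T2Space X] {f : (ℕ → Bool) → X}
    (hf : Continuous f) (hinj : Function.Injective f) : IsCantorSet (range f) :=
  ⟨(hf.isClosedEmbedding hinj).isEmbedding.toHomeomorph.symm⟩

/-- An uncountable family of `E`-classes, coded in Baire space by points of the first coordinate of a
parametrization of the complement of `E`. -/
theorem exists_not_countable_inequivalent {X : Type*} {E : Setoid X} {Y : Set X}
    (hY : ¬ {c ∈ E.classes | (c ∩ Y).Nonempty}.Countable) {B : Type*} {g : B → X × X}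
    (hg : range g = {p : X × X | E p.1 p.2}ᶜ) :
    ∃ P : Set B, ¬ P.Countable ∧ (∀ a ∈ P, (g a).1 ∈ Y) ∧
      ∀ a ∈ P, ∀ b ∈ P, a ≠ b → ¬ E (g a).1 (g b).1 := by
  have hcode : ∀ c : {c ∈ E.classes | (c ∩ Y).Nonempty}, ∃ a, (g a).1 ∈ c.1 ∩ Y := by
    rintro ⟨c, hc, y, hyc, hyY⟩
    -- Without such a point there would be only one class.
    obtain ⟨y', hy'⟩ : ∃ y', ¬ E y y' := by
      by_contra! hcon
      refine hY (Set.Countable.mono ?_ (countable_singleton c))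
      rintro d ⟨hd, z, hzd, -⟩
      exact Setoid.eq_of_mem_classes hd hzd hc
        ((Setoid.rel_iff_exists_classes E).1 (hcon z) |>.elim fun b hb =>
          (Setoid.eq_of_mem_classes hc hyc hb.1 hb.2.1) ▸ hb.2.2)
    obtain ⟨a, ha⟩ : (y, y') ∈ range g := by rw [hg]; exact hy'
    exact ⟨a, by rw [ha]; exact ⟨hyc, hyY⟩⟩
  choose a ha using hcode
  have hinj : Function.Injective a := fun c d hcd => Subtype.ext
    (Setoid.eq_of_mem_classes c.2.1 (ha c).1 d.2.1 (hcd ▸ (ha d).1))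
  refine ⟨range a, fun h => hY ?_, ?_, ?_⟩
  · have := h.to_subtype
    exact countable_coe_iff.1 ((rangeFactorization_injective.2 hinj).countable)
  · rintro _ ⟨c, rfl⟩
    exact (ha c).2
  · rintro _ ⟨c, rfl⟩ _ ⟨d, rfl⟩ hne hE
    refine hne (congrArg a (Subtype.ext ?_))
    obtain ⟨b, hb, h1, h2⟩ := (Setoid.rel_iff_exists_classes E).1 hE
    exact (Setoid.eq_of_mem_classes c.2.1 (ha c).1 hb h1).trans
      (Setoid.eq_of_mem_classes hb h2 d.2.1 (ha d).1)

theorem theorem2p3 {X : Type*} [TopologicalSpace X] [T2Space X]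
    (E : Setoid X) (hE : IsCoanalytic {p : X × X | E p.1 p.2})
    (R : X → X → Prop) (hR_refl : ∀ x, R x x) (hR : IsGδ {p : X × X | R p.1 p.2})
    (hY : ∃ Y : Set X, IsRClique R Y ∧ ¬ {c ∈ E.classes | (c ∩ Y).Nonempty}.Countable) :
    ∃ C : Set X, IsCantorSet C ∧ IsPartialTransversal E C ∧ IsRClique R C := by
  obtain ⟨Y, hYR, hYE⟩ := hY
  obtain ⟨g, hgc, hg⟩ : ∃ g : (ℕ → ℕ) → X × X, Continuous g ∧
      range g = {p : X × X | E p.1 p.2}ᶜ := by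
    have h := hE
    rw [IsCoanalytic, AnalyticSet] at h
    refine h.resolve_left fun h0 => hYE ?_
    refine Set.Subsingleton.countable ?_
    rintro c ⟨hc, y, hyc, -⟩ d ⟨hd, z, hzd, -⟩
    obtain ⟨b, hb, h1, h2⟩ := (Setoid.rel_iff_exists_classes E).1
      (show (y, z) ∈ {p : X × X | E p.1 p.2} from compl_empty_iff.1 h0 ▸ mem_univ _)
    exact (Setoid.eq_of_mem_classes hc hyc hb h1).trans (Setoid.eq_of_mem_classes hb h2 hd hzd)
  obtain ⟨P, hP, hPY, hPE⟩ := exists_not_countable_inequivalent hYE hg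
  obtain ⟨U, hU, hRU⟩ := isGδ_iff_eq_iInter_nat.1 hR
  obtain ⟨e, he⟩ := exists_dense_vertices
  have hπ : Continuous fun a => (g a).1 := hgc.fst
  obtain ⟨φ, hφ, hφU, hφT⟩ := exists_continuous_edges_of_not_countable hP
    (T := {t | g t.2.2 = ((g t.1).1, (g t.2.1).1)})
    (isClosed_eq (by fun_prop) (by fun_prop))
    (fun a ha b hb hab => by
      have : ((g a).1, (g b).1) ∈ range g := by rw [hg]; exact hPE a ha b hb hab
      exact this)
    (U := fun k => {p | ((g p.1).1, (g p.2).1) ∈ U k})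
    (fun k => (hU k).preimage (f := fun p : (ℕ → ℕ) × (ℕ → ℕ) => ((g p.1).1, (g p.2).1))
      (by fun_prop))
    (fun a ha b hb k => by
      have : ((g a).1, (g b).1) ∈ {p : X × X | R p.1 p.2} := by
        -- The diagonal needs reflexivity of `R`.
        rcases eq_or_ne (g a).1 (g b).1 with h | h
        · rw [h]; exact hR_refl _
        · exact hYR _ (hPY a ha) _ (hPY b hb) h
      rw [hRU] at this
      exact mem_iInter.1 this k) e
  let Φ : (ℕ → Bool) → X := fun x => (g (φ x)).1
  have hΦ : Continuous Φ := hπ.comp hφ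
  have hΦR : ∀ x y, R (Φ x) (Φ y) := fun x y => by
    have : (Φ x, Φ y) ∈ {p : X × X | R p.1 p.2} := hRU ▸ mem_iInter.2 (hφU x y)
    exact this
  have : PolishSpace ((ℕ → Bool) × (ℕ → Bool)) := { }
  have hres := compl_mem_residual_of_flip (E.comap Φ)
    (AnalyticSet.baireMeasurableSet (AnalyticSet.preimage hE
      (f := fun p : (ℕ → Bool) × (ℕ → Bool) => (Φ p.1, Φ p.2)) (by fun_prop))).of_compl e he
    (fun n x hx hEx => by
      obtain ⟨w, hw⟩ := hφT n x hx
      have : g w ∈ range g := mem_range_self w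
      rw [hg, show g w = _ from hw] at this
      exact this hEx)
  obtain ⟨ψ, hψ, hψE⟩ := exists_continuous_pairwise_mem_of_residual hres
  have hinj : Function.Injective (Φ ∘ ψ) := fun x y hxy => by
    by_contra hne
    refine hψE x y hne ?_
    change E (Φ (ψ x)) (Φ (ψ y))
    rw [show Φ (ψ x) = Φ (ψ y) from hxy]
  refine ⟨range (Φ ∘ ψ), isCantorSet_range (hΦ.comp hψ) hinj, ?_, ?_⟩
  · rintro _ ⟨x, rfl⟩ _ ⟨y, rfl⟩ hne
    exact hψE x y fun h => hne (h ▸ rfl)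
  · rintro _ ⟨x, rfl⟩ _ ⟨y, rfl⟩ _
    exact hΦR _ _
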